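/- Let $P_l$ denote the path on $l$ vertices, let $\cup$ denote disjoint union of graphs, and let $mG$ denote the disjoint union of $m$ copies of $G$. For a graph $H$, the anti-Ramsey number $AR(n,H)$ is the maximum number of colours in a (not necessarily proper) edge-colouring of the complete graph $K_n$ that contains no rainbow copy of $H$, that is, no subgraph isomorphic to $H$ all of whose edges have distinct colours. Theorem. Let $k$, $t$ and $n$ be integers with $t \ge k+1 \ge 2$ and $n \ge 8k+2t-4$. Then \[ AR(n,\, kP_4 \cup tP_2) = AR(n,\, (2k+t)P_2). \] -/

import Mathlib

open SimpleGraph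

/-- The disjoint union `k G` of `k` copies of a graph `G`: two vertices are adjacent iff they lie
in the same copy and are adjacent in `G`. -/
def disjointCopies {V : Type*} (k : ℕ) (G : SimpleGraph V) : SimpleGraph (Fin k × V) where
  Adj x y := x.1 = y.1 ∧ G.Adj x.2 y.2
  symm := ⟨fun _ _ h => ⟨h.1.symm, h.2.symm⟩⟩
  loopless := ⟨fun _ h => G.loopless.irrefl _ h.2⟩

/-- An edge-colouring `c` of `G` (not necessarily proper) contains a rainbow copy of `H`: there is
a (not necessarily induced) copy of `H` in `G` whose edges receive pairwise distinct colours. -/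
def HasRainbowCopy {V W C : Type*} {G : SimpleGraph V} (c : G.EdgeLabeling C)
    (H : SimpleGraph W) : Prop :=
  ∃ f : Copy H G, Function.Injective fun e : H.edgeSet => c (f.toHom.mapEdgeSet e)

/-- The numbers `m` such that some edge-colouring of `K_n` with exactly `m` colours contains no
rainbow copy of `H`. -/
def rainbowFreeColorCounts {W : Type*} (n : ℕ) (H : SimpleGraph W) : Set ℕ :=
  {m | ∃ c : (completeGraph (Fin n)).EdgeLabeling (Fin m),
    Function.Surjective c ∧ ¬ HasRainbowCopy c H}

/-- The anti-Ramsey number `AR(n, H)`: the maximum number of colours in an edge-colouring of `K_n`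
without a rainbow copy of `H`. -/
noncomputable def antiRamsey {W : Type*} (n : ℕ) (H : SimpleGraph W) : ℕ :=
  sSup (rainbowFreeColorCounts n H)

theorem bddAbove_rainbowFreeColorCounts {W : Type*} (n : ℕ) (H : SimpleGraph W) :
    BddAbove (rainbowFreeColorCounts n H) := by
  refine ⟨Nat.card (completeGraph (Fin n)).edgeSet, ?_⟩
  rintro m ⟨c, hc, -⟩
  simpa using Nat.card_le_card_of_surjective c hc

/-- If `H` has at least two edges and `n ≥ 2`, the supremum defining `AR(n, H)` is a maximum. -/
theorem isGreatest_antiRamsey {W : Type*} {n : ℕ} (hn : 2 ≤ n) {H : SimpleGraph W}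
    (hH : H.edgeSet.Nontrivial) :
    IsGreatest (rainbowFreeColorCounts n H) (antiRamsey n H) := by
  have hne : (rainbowFreeColorCounts n H).Nonempty := by
    refine ⟨1, fun _ => 0, fun y => ⟨⟨s(⟨0, by omega⟩, ⟨1, by omega⟩), by simp⟩,
      Subsingleton.elim _ _⟩, ?_⟩
    rintro ⟨f, hf⟩
    obtain ⟨a, ha, b, hb, hab⟩ := hH
    exact hab (congrArg Subtype.val (@hf ⟨a, ha⟩ ⟨b, hb⟩ rfl))
  exact ⟨Nat.sSup_mem hne (bddAbove_rainbowFreeColorCounts n H),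
    fun m hm => le_csSup (bddAbove_rainbowFreeColorCounts n H) hm⟩

/-! Splitting each `P₄` into its two end edges shows that `k P₄ ∪ t P₂` contains a matching of `2k +
t` edges, which gives one inequality.

For the other, take a colouring with more colours than the matching allows. It has a rainbow
matching of `2k + t` edges, and pairs of matching edges are traded for paths one at a time: a
rainbow `h P₄ ∪ (t + 2) P₂` forces a rainbow `(h + 1) P₄ ∪ t P₂` (`HasRainbowCopy.exchange`). Extend
the given copy to a graph `G` with one edge of each colour, so that every subgraph of `G` is
rainbow. If `G` lacked the next graph, it would have few edges: local exchanges limit the edges from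
the paths to the matching and to the uncovered vertices, and off the paths the average degree is at
most two (`two_mul_card_edgeSet_le`). But `G` has as many edges as there are colours, which exceeds
the explicit lower bound `le_antiRamsey_matching`, a contradiction. -/

/-! ### Packings of paths and edges -/

/-- The map `f` places the disjoint paths `P₄` indexed by `I` and the disjoint edges indexed by
`J` into `G`. -/
structure IsPacking {V I J : Type*} (G : SimpleGraph V) (f : I × Fin 4 ⊕ J × Fin 2 → V) :
    Prop where
  inj : Function.Injective f
  path : ∀ i, G.Adj (f (.inl (i, 0))) (f (.inl (i, 1))) ∧
    G.Adj (f (.inl (i, 1))) (f (.inl (i, 2))) ∧ G.Adj (f (.inl (i, 2))) (f (.inl (i, 3)))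
  edge : ∀ j, G.Adj (f (.inr (j, 0))) (f (.inr (j, 1)))

/-- `G` contains `a P₄ ∪ b P₂` with all vertices in `S`. -/
def Packs {V : Type*} (G : SimpleGraph V) (S : Set V) (a b : ℕ) : Prop :=
  ∃ f : Fin a × Fin 4 ⊕ Fin b × Fin 2 → V, IsPacking G f ∧ ∀ x, f x ∈ S

/-- Arbitrary index types let packings be assembled over sums and subtypes; the inequalities allow
surplus components to be dropped. -/
theorem Packs.of_isPacking {V I J : Type*} [Fintype I] [Fintype J] {G : SimpleGraph V}
    {S : Set V} {a b : ℕ} {f : I × Fin 4 ⊕ J × Fin 2 → V} (hf : IsPacking G f)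
    (hS : ∀ x, f x ∈ S) (ha : a ≤ Fintype.card I) (hb : b ≤ Fintype.card J) :
    Packs G S a b := by
  obtain ⟨g⟩ : Nonempty (Fin a ↪ I) := Function.Embedding.nonempty_of_card_le (by simpa)
  obtain ⟨g'⟩ : Nonempty (Fin b ↪ J) := Function.Embedding.nonempty_of_card_le (by simpa)
  refine ⟨f ∘ Sum.map (Prod.map g id) (Prod.map g' id), ⟨?_, fun i => ?_, fun j => ?_⟩,
    fun x => hS _⟩
  · exact hf.inj.comp (Function.Injective.sumMap
      (Function.Injective.prodMap g.injective Function.injective_id)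
      (Function.Injective.prodMap g'.injective Function.injective_id))
  · exact hf.path (g i)
  · exact hf.edge (g' j)

theorem Packs.mono {V : Type*} {G : SimpleGraph V} {S T : Set V} {a b a' b' : ℕ}
    (h : Packs G S a b) (hST : S ⊆ T) (ha : a' ≤ a) (hb : b' ≤ b) : Packs G T a' b' := by
  obtain ⟨f, hf, hS⟩ := h
  exact .of_isPacking hf (fun x => hST (hS x)) (by simpa) (by simpa)

theorem Packs.union {V : Type*} {G : SimpleGraph V} {S T : Set V} {a b a' b' : ℕ}
    (h : Packs G S a b) (h' : Packs G T a' b') (hST : Disjoint S T) :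
    Packs G (S ∪ T) (a + a') (b + b') := by
  obtain ⟨f, hf, hS⟩ := h
  obtain ⟨g, hg, hT⟩ := h'
  have hne : ∀ x y, f x ≠ g y := fun x y h => Set.disjoint_left.mp hST (hS x) (h ▸ hT y)
  refine .of_isPacking (I := Fin a ⊕ Fin a') (J := Fin b ⊕ Fin b')
    (f := Sum.elim (fun p => p.1.elim (fun i => f (.inl (i, p.2))) (fun i => g (.inl (i, p.2))))
      (fun p => p.1.elim (fun i => f (.inr (i, p.2))) (fun i => g (.inr (i, p.2)))))
    ⟨?_, ?_, ?_⟩ ?_ (by simp) (by simp)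
  · rintro (⟨i | i, l⟩ | ⟨i | i, l⟩) (⟨j | j, m⟩ | ⟨j | j, m⟩) h <;>
      simp only [Sum.elim_inl, Sum.elim_inr] at h <;>
      first
        | exact absurd h (hne _ _)
        | exact absurd h.symm (hne _ _)
        | (have := hf.inj h; simp_all)
        | (have := hg.inj h; simp_all)
  · rintro (i | i)
    exacts [hf.path i, hg.path i]
  · rintro (i | i)
    exacts [hf.edge i, hg.edge i]
  · rintro (⟨i | i, l⟩ | ⟨i | i, l⟩)
    exacts [.inl (hS _), .inr (hT _), .inl (hS _), .inr (hT _)]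

theorem packs_path {V : Type*} {G : SimpleGraph V} {w x y z : V} (h₁ : G.Adj w x)
    (h₂ : G.Adj x y) (h₃ : G.Adj y z) (hwy : w ≠ y) (hwz : w ≠ z) (hxz : x ≠ z) :
    Packs G {w, x, y, z} 1 0 := by
  refine .of_isPacking (I := Unit) (J := Empty) (f := Sum.elim (fun p => ![w, x, y, z] p.2)
    (fun p => p.1.elim)) ⟨?_, fun _ => ⟨h₁, h₂, h₃⟩, fun j => j.elim⟩ ?_ (by simp) (by simp)
  · rintro (⟨⟨⟩, l⟩ | ⟨⟨⟩, l⟩) (⟨⟨⟩, m⟩ | ⟨⟨⟩, m⟩) h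
    have := h₁.ne
    have := h₂.ne
    have := h₃.ne
    fin_cases l <;> fin_cases m <;> simp_all
  · rintro (⟨⟨⟩, l⟩ | ⟨⟨⟩, l⟩)
    fin_cases l <;> simp

theorem packs_edge {V : Type*} {G : SimpleGraph V} {x y : V} (h : G.Adj x y) :
    Packs G {x, y} 0 1 := by
  refine .of_isPacking (I := Empty) (J := Unit) (f := Sum.elim (fun p => p.1.elim)
    (fun p => ![x, y] p.2)) ⟨?_, fun i => i.elim, fun _ => h⟩ ?_ (by simp) (by simp)
  · rintro (⟨⟨⟩, l⟩ | ⟨⟨⟩, l⟩) (⟨⟨⟩, m⟩ | ⟨⟨⟩, m⟩) e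
    have := h.ne
    fin_cases l <;> fin_cases m <;> simp_all
  · rintro (⟨⟨⟩, l⟩ | ⟨⟨⟩, l⟩)
    fin_cases l <;> simp

/-- The part of a packing formed by the paths in `A` and the edges in `B`. -/
theorem IsPacking.packs_image {V I J : Type*} {G : SimpleGraph V}
    {f : I × Fin 4 ⊕ J × Fin 2 → V} (hf : IsPacking G f) (A : Finset I) (B : Finset J) :
    Packs G (f '' {x | x.elim (fun p => p.1 ∈ A) (fun p => p.1 ∈ B)}) A.card B.card := by
  refine .of_isPacking (I := A) (J := B)
    (f := f ∘ Sum.map (Prod.map (↑) id) (Prod.map (↑) id)) ⟨?_, fun i => hf.path i,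
      fun j => hf.edge j⟩ ?_ (by simp) (by simp)
  · exact hf.inj.comp (Function.Injective.sumMap
      (Function.Injective.prodMap Subtype.val_injective Function.injective_id)
      (Function.Injective.prodMap Subtype.val_injective Function.injective_id))
  · rintro (⟨i, l⟩ | ⟨i, l⟩)
    · exact ⟨_, by simp, rfl⟩
    · exact ⟨_, by simp, rfl⟩

theorem IsPacking.adj_edge {V I J : Type*} {G : SimpleGraph V}
    {f : I × Fin 4 ⊕ J × Fin 2 → V} (hf : IsPacking G f) (j : J) {b b' : Fin 2} (h : b ≠ b') :
    G.Adj (f (.inr (j, b))) (f (.inr (j, b'))) := by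
  fin_cases b <;> fin_cases b' <;> first | exact absurd rfl h | exact hf.edge j |
    exact (hf.edge j).symm

theorem packs_univ_iff {V : Type*} {G : SimpleGraph V} {a b : ℕ} :
    Packs G Set.univ a b ↔
      disjointCopies a (pathGraph 4) ⊕g disjointCopies b (pathGraph 2) ⊑ G := by
  constructor
  · rintro ⟨f, hf, -⟩
    refine ⟨⟨⟨f, ?_⟩, hf.inj⟩⟩
    rintro (⟨i, l⟩ | ⟨i, l⟩) (⟨j, m⟩ | ⟨j, m⟩) h
    · obtain ⟨rfl, h⟩ : i = j ∧ (pathGraph 4).Adj l m := h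
      obtain ⟨h₁, h₂, h₃⟩ := hf.path i
      rw [pathGraph_adj] at h
      fin_cases l <;> fin_cases m <;> simp at h <;>
        first | assumption | (apply SimpleGraph.Adj.symm; assumption)
    · cases h
    · cases h
    · obtain ⟨rfl, h⟩ : i = j ∧ (pathGraph 2).Adj l m := h
      exact hf.adj_edge i h.ne
  · rintro ⟨f⟩
    refine ⟨f, ⟨f.injective, fun i => ⟨?_, ?_, ?_⟩, fun j => ?_⟩, fun _ => trivial⟩ <;>
      exact f.toHom.map_adj ⟨rfl, by simp [pathGraph_adj]⟩

theorem disjointCopies_path_two_isContained_sum (s : ℕ) :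
    disjointCopies s (pathGraph 2) ⊑
      disjointCopies 0 (pathGraph 4) ⊕g disjointCopies s (pathGraph 2) :=
  ⟨Embedding.sumInr.toCopy⟩

theorem sum_isContained_disjointCopies_path_two (s : ℕ) :
    disjointCopies 0 (pathGraph 4) ⊕g disjointCopies s (pathGraph 2) ⊑
      disjointCopies s (pathGraph 2) := by
  rw [← packs_univ_iff]
  refine ⟨Sum.elim (fun p => p.1.elim0) id, ⟨?_, fun i => i.elim0, fun j => ?_⟩,
    fun _ => trivial⟩
  · rintro (⟨i, -⟩ | p) (⟨j, -⟩ | q) h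
    · exact i.elim0
    · exact i.elim0
    · exact j.elim0
    · exact congrArg _ h
  · exact ⟨rfl, by simp [pathGraph_adj]⟩

theorem Packs.split_paths {V : Type*} {G : SimpleGraph V} {S : Set V} {a b : ℕ}
    (h : Packs G S a b) : Packs G S 0 (2 * a + b) := by
  obtain ⟨f, hf, hS⟩ := h
  refine .of_isPacking (I := Empty) (J := Fin a ⊕ Fin a ⊕ Fin b)
    (f := Sum.elim (fun p => p.1.elim) (fun p => p.1.elim (fun i => f (.inl (i, ![0, 1] p.2)))
      (Sum.elim (fun i => f (.inl (i, ![2, 3] p.2))) (fun j => f (.inr (j, p.2))))))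
    ⟨?_, fun i => i.elim, ?_⟩ ?_ (by simp) (by simp; omega)
  · rintro (⟨⟨⟩, -⟩ | ⟨i | i | i, l⟩) (⟨⟨⟩, -⟩ | ⟨j | j | j, m⟩) h <;>
      fin_cases l <;> fin_cases m <;> have := hf.inj h <;> first | (simp at this; done) | simpa using this
  · rintro (i | i | i)
    exacts [(hf.path i).1, (hf.path i).2.2, hf.edge i]
  · rintro (⟨⟨⟩, -⟩ | ⟨i | i | i, l⟩) <;> exact hS _

/-! ### Rainbow copies and transversals -/

theorem HasRainbowCopy.of_isContained {V W W' C : Type*} {G : SimpleGraph V}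
    {c : G.EdgeLabeling C} {H : SimpleGraph W} {H' : SimpleGraph W'} (h : HasRainbowCopy c H)
    (hH : H' ⊑ H) : HasRainbowCopy c H' := by
  obtain ⟨f, hf⟩ := h
  obtain ⟨g⟩ := hH
  refine ⟨f.comp g, fun e e' he => g.mapEdgeSet.injective (@hf _ _ ?_)⟩
  have key : ∀ e : H'.edgeSet, (f.comp g).toHom.mapEdgeSet e =
      f.toHom.mapEdgeSet (g.mapEdgeSet e) := by
    rintro ⟨e, he⟩
    induction e with | _ x y => rfl
  simpa only [key] using he

/-- A graph on whose edges the colouring is injective contains only rainbow subgraphs. -/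
theorem HasRainbowCopy.of_injOn {V W C : Type*} {c : (completeGraph V).EdgeLabeling C}
    {G : SimpleGraph V} {H : SimpleGraph W}
    (hG : ∀ e e' : (completeGraph V).edgeSet, e.1 ∈ G.edgeSet → e'.1 ∈ G.edgeSet → c e = c e' →
      e = e') (h : H ⊑ G) : HasRainbowCopy c H := by
  obtain ⟨f⟩ := h
  let g : Copy H (completeGraph V) := (Copy.ofLE G (completeGraph V) le_top).comp f
  have hmem : ∀ e : H.edgeSet, (g.toHom.mapEdgeSet e).1 ∈ G.edgeSet := by
    rintro ⟨e, he⟩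
    induction e with | _ x y => exact f.toHom.map_adj he
  refine ⟨g, fun e e' he => g.mapEdgeSet.injective ?_⟩
  exact hG _ _ (hmem e) (hmem e') he

/-- A rainbow copy extends to a graph with exactly one edge of every colour. -/
theorem HasRainbowCopy.exists_transversal {V W C : Type*} {c : (completeGraph V).EdgeLabeling C}
    (hc : Function.Surjective c) {H : SimpleGraph W} (h : HasRainbowCopy c H) :
    ∃ G : SimpleGraph V, H ⊑ G ∧ Nat.card G.edgeSet = Nat.card C ∧
      ∀ e e' : (completeGraph V).edgeSet, e.1 ∈ G.edgeSet → e'.1 ∈ G.edgeSet → c e = c e' →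
        e = e' := by
  classical
  obtain ⟨f, hf⟩ := h
  -- One edge is chosen per colour; if the copy already uses the colour, its own edge must be the
  -- one chosen.
  have hg : ∀ i : C, ∃ e, c e = i ∧ ∀ e' : H.edgeSet, c (f.toHom.mapEdgeSet e') = i →
      e = f.toHom.mapEdgeSet e' := by
    intro i
    by_cases hi : ∃ e' : H.edgeSet, c (f.toHom.mapEdgeSet e') = i
    · obtain ⟨e', he'⟩ := hi
      exact ⟨_, he', fun e'' he'' => congrArg _ (@hf e' e'' (he'.trans he''.symm))⟩
    · obtain ⟨e, he⟩ := hc i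
      exact ⟨e, he, fun e' he' => (hi ⟨e', he'⟩).elim⟩
  choose g hgc hgf using hg
  have hE : (fromEdgeSet (Set.range fun i => (g i).1)).edgeSet = Set.range fun i => (g i).1 := by
    rw [edgeSet_fromEdgeSet, sdiff_eq_left, Set.disjoint_left]
    rintro _ ⟨i, rfl⟩ hd
    exact (completeGraph V).not_isDiag_of_mem_edgeSet (g i).2 hd
  refine ⟨fromEdgeSet (Set.range fun i => (g i).1), ⟨⟨⟨f, ?_⟩, f.injective⟩⟩, ?_, ?_⟩
  · intro x y hxy
    rw [← mem_edgeSet, hE]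
    exact ⟨_, congrArg Subtype.val (hgf _ ⟨s(x, y), hxy⟩ rfl)⟩
  · rw [hE]
    refine Nat.card_range_of_injective fun i j hij => ?_
    rw [← hgc i, ← hgc j, Subtype.ext hij]
  · intro e e' he he' hee
    rw [hE] at he he'
    obtain ⟨i, hi⟩ := he
    obtain ⟨j, hj⟩ := he'
    obtain rfl : g i = e := Subtype.ext hi
    obtain rfl : g j = e' := Subtype.ext hj
    rw [hgc, hgc] at hee
    rw [hee]

/-! ### Lower bound for matchings -/

/-- If the edges meeting a set of `p` vertices get distinct colours and all other edges get one
further colour, there is no rainbow matching with `p + 2` edges. -/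
theorem le_antiRamsey_matching {n p : ℕ} (hp : p + 2 ≤ n) :
    n.choose 2 - (n - p).choose 2 + 1 ≤
      antiRamsey n (disjointCopies (p + 2) (pathGraph 2)) := by
  classical
  let Q : Finset (Fin n) := Finset.univ.filter fun i => p ≤ i.1
  have hQ : Q.card = n - p := by
    have : Q = Finset.univ.filter fun i : Fin n => ¬ i.1 < p := by simp [Q]
    have h1 : (Finset.univ.filter fun i : Fin n => i.1 < p).card = p := by
      rw [Fin.card_filter_val_lt]; omega
    have h2 := Finset.card_filter_add_card_filter_not (s := (Finset.univ : Finset (Fin n)))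
      (fun i => i.1 < p)
    rw [this]
    simp only [Finset.card_univ, Fintype.card_fin] at h2
    omega
  let E₀ : Finset (Sym2 (Fin n)) := Q.offDiag.image (Function.uncurry Sym2.mk)
  let E : Finset (Sym2 (Fin n)) := (completeGraph (Fin n)).edgeFinset \ E₀
  have hE : E.card = n.choose 2 - (n - p).choose 2 := by
    rw [Finset.card_sdiff_of_subset, Sym2.card_image_offDiag, hQ,
      card_edgeFinset_top_eq_card_choose_two, Fintype.card_fin]
    intro e he
    obtain ⟨⟨x, y⟩, hxy, rfl⟩ := Finset.mem_image.mp he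
    simpa using (Finset.mem_offDiag.mp hxy).2.2
  -- `none` is the common colour of the edges inside `Q`; every other edge is its own colour.
  let c : (completeGraph (Fin n)).EdgeLabeling (Option E) := fun e =>
    if h : e.1 ∈ E then some ⟨e.1, h⟩ else none
  have hcs : Function.Surjective c := by
    rintro (_ | ⟨e, he⟩)
    · refine ⟨⟨s(⟨p, by omega⟩, ⟨p + 1, by omega⟩), by simp⟩, dif_neg fun h => ?_⟩
      refine (Finset.mem_sdiff.mp h).2 (Finset.mem_image.mpr
        ⟨(⟨p, by omega⟩, ⟨p + 1, by omega⟩), ?_, rfl⟩)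
      simp [Q]
    · exact ⟨⟨e, mem_edgeFinset.mp (Finset.mem_sdiff.mp he).1⟩, dif_pos he⟩
  have hnone : ∀ x y : Fin n, ∀ h : s(x, y) ∈ (completeGraph (Fin n)).edgeSet,
      p ≤ x.1 → p ≤ y.1 → c ⟨s(x, y), h⟩ = none := by
    intro x y h hx hy
    refine dif_neg fun h' => (Finset.mem_sdiff.mp h').2 (Finset.mem_image.mpr ⟨(x, y), ?_, rfl⟩)
    have : x ≠ y := by simpa using h
    simp [Q, hx, hy, this]
  have hfree : ¬ HasRainbowCopy c (disjointCopies (p + 2) (pathGraph 2)) := by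
    rintro ⟨f, hf⟩
    have hadj : ∀ j : Fin (p + 2), (disjointCopies (p + 2) (pathGraph 2)).Adj (j, 0) (j, 1) :=
      fun j => ⟨rfl, by simp [pathGraph_adj]⟩
    let T : Finset (Fin (p + 2)) := Finset.univ.filter fun j =>
      p ≤ (f (j, 0)).1 ∧ p ≤ (f (j, 1)).1
    have hT : T.card ≤ 1 := by
      refine Finset.card_le_one.mpr fun i hi j hj => ?_
      simp only [T, Finset.mem_filter, Finset.mem_univ, true_and] at hi hj
      have := @hf ⟨s((i, 0), (i, 1)), hadj i⟩ ⟨s((j, 0), (j, 1)), hadj j⟩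
        ((hnone (f (i, 0)) (f (i, 1)) (f.toHom.map_adj (hadj i)) hi.1 hi.2).trans
          (hnone (f (j, 0)) (f (j, 1)) (f.toHom.map_adj (hadj j)) hj.1 hj.2).symm)
      simpa using congrArg Subtype.val this
    -- Each matching edge outside `T` uses up one of the first `p` vertices.
    have hTc : Tᶜ.card ≤ p := by
      have hex : ∀ j ∈ Tᶜ, ∃ l, (f (j, l)).1 < p := by
        intro j hj
        simp only [T, Finset.mem_compl, Finset.mem_filter, Finset.mem_univ, true_and,
          not_and_or, not_le] at hj
        exact hj.elim (fun h => ⟨0, h⟩) fun h => ⟨1, h⟩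
      choose! l hl using hex
      have := Finset.card_le_card_of_injOn (s := Tᶜ) (t := Finset.range p)
        (fun j => (f (j, l j)).1) (fun j hj => by simpa using hl j hj) (fun i _ j _ h => by
          have := f.injective (Fin.ext h)
          exact congrArg Prod.fst this)
      simpa using this
    have := Finset.card_add_card_compl T
    simp only [Fintype.card_fin] at this
    omega
  refine le_csSup (bddAbove_rainbowFreeColorCounts _ _) ?_
  have hcard : Fintype.card (Option E) = n.choose 2 - (n - p).choose 2 + 1 := by
    rw [Fintype.card_option, Fintype.card_coe, hE]
  let e : Option E ≃ Fin (n.choose 2 - (n - p).choose 2 + 1) := Fintype.equivFinOfCardEq hcard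
  refine ⟨fun x => e (c x), e.surjective.comp hcs, ?_⟩
  rintro ⟨f, hf⟩
  exact hfree ⟨f, fun x y h => hf (congrArg e h)⟩

/-! ### Counting adjacent pairs -/

open Classical in
/-- The number of ordered pairs in `S × T` that are adjacent in `G`. -/
noncomputable def adjCount {V : Type*} (G : SimpleGraph V) (S T : Finset V) : ℕ :=
  ∑ x ∈ S, (T.filter (G.Adj x)).card

theorem adjCount_univ {V : Type*} [Fintype V] (G : SimpleGraph V) :
    adjCount G Finset.univ Finset.univ = 2 * Nat.card G.edgeSet := by
  classical
  rw [Nat.card_eq_fintype_card, ← edgeFinset_card, ← sum_degrees_eq_twice_card_edges]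
  refine Finset.sum_congr rfl fun x _ => ?_
  rw [← card_neighborFinset_eq_degree]
  congr 1
  ext y
  simp

theorem adjCount_comm {V : Type*} (G : SimpleGraph V) (S T : Finset V) :
    adjCount G S T = adjCount G T S := by
  classical
  simp only [adjCount, Finset.card_filter]
  rw [Finset.sum_comm]
  simp only [G.adj_comm]

theorem adjCount_union_left {V : Type*} [DecidableEq V] (G : SimpleGraph V) {S S' : Finset V}
    (h : Disjoint S S') (T : Finset V) :
    adjCount G (S ∪ S') T = adjCount G S T + adjCount G S' T :=
  Finset.sum_union h

theorem adjCount_union_right {V : Type*} [DecidableEq V] (G : SimpleGraph V) {T T' : Finset V}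
    (S : Finset V) (h : Disjoint T T') :
    adjCount G S (T ∪ T') = adjCount G S T + adjCount G S T' := by
  rw [adjCount_comm, adjCount_union_left G h, adjCount_comm, adjCount_comm G T']

theorem adjCount_union_self {V : Type*} [DecidableEq V] (G : SimpleGraph V) {S T : Finset V}
    (h : Disjoint S T) :
    adjCount G (S ∪ T) (S ∪ T) = adjCount G S S + 2 * adjCount G S T + adjCount G T T := by
  rw [adjCount_union_left G h, adjCount_union_right G S h, adjCount_union_right G T h,
    adjCount_comm G T S]
  ring

theorem adjCount_self_le {V : Type*} (G : SimpleGraph V) (S : Finset V) :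
    adjCount G S S ≤ S.card * (S.card - 1) := by
  classical
  refine Finset.sum_le_card_nsmul _ _ _ fun x hx => ?_
  rw [← Finset.card_erase_of_mem hx]
  refine Finset.card_le_card fun y hy => ?_
  have := Finset.mem_filter.mp hy
  exact Finset.mem_erase.mpr ⟨this.2.ne', this.1⟩

/-! ### Exchanges in a graph without `P₄ ∪ t P₂` -/

/-- Replace the paths in `A` and the edges in `B` by a packing on other vertices. -/
theorem IsPacking.exchange {V I J : Type*} [Fintype I] [Fintype J] {G : SimpleGraph V}
    {f : I × Fin 4 ⊕ J × Fin 2 → V} (hf : IsPacking G f) {S R : Set V} (hS : ∀ x, f x ∈ S)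
    (A : Finset I) (B : Finset J) {a b a' b' : ℕ} (hR : Packs G R a b) (hRS : R ⊆ S)
    (hA : ∀ i ∉ A, ∀ l, f (.inl (i, l)) ∉ R) (hB : ∀ j ∉ B, ∀ l, f (.inr (j, l)) ∉ R)
    (ha' : a' ≤ Fintype.card I - A.card + a) (hb' : b' ≤ Fintype.card J - B.card + b) :
    Packs G S a' b' := by
  classical
  have h := (hf.packs_image Aᶜ Bᶜ).union hR ?_
  · rw [Finset.card_compl, Finset.card_compl] at h
    refine h.mono (Set.union_subset ?_ hRS) ha' hb'
    rintro _ ⟨x, -, rfl⟩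
    exact hS x
  · rw [Set.disjoint_left]
    rintro _ ⟨⟨i, l⟩ | ⟨i, l⟩, h, rfl⟩
    · exact hA i (by simpa using h) l
    · exact hB i (by simpa using h) l

theorem fin_two_add_one_ne (b : Fin 2) : b + 1 ≠ b := by
  fin_cases b <;> simp

/-- A graph with a matching of `t + 2` edges but without `P₄ ∪ t P₂` has average degree at
most two. -/
theorem adjCount_self_le_of_not_packs {V : Type*} (G : SimpleGraph V) (T : Finset V) {t : ℕ}
    (h : Packs G T 0 (t + 2)) (hn : ¬ Packs G T 1 t) : adjCount G T T ≤ 2 * T.card := by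
  classical
  have hbound : ∀ r, Packs G T 0 r → r ≤ T.card := by
    rintro r ⟨f, hf, hT⟩
    have := Finset.card_le_card_of_injOn (s := Finset.univ) (t := T)
      (fun j : Fin r => f (.inr (j, 0))) (fun j _ => hT _) (fun i _ j _ h => by
        simpa using hf.inj h)
    simpa using this
  -- A maximum matching is taken so that the uncovered set `U` is independent.
  obtain ⟨r, ⟨hr, htr⟩, hmax⟩ : ∃ r, (Packs G T 0 r ∧ t + 2 ≤ r) ∧ ¬ Packs G T 0 (r + 1) := by
    by_contra! hcon
    have : ∀ d, Packs G T 0 (t + 2 + d) := by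
      intro d
      induction d with
      | zero => exact h
      | succ d ih => exact hcon _ ⟨ih, Nat.le_add_right _ _⟩
    have := hbound _ (this T.card)
    omega
  obtain ⟨f, hf, hT⟩ := hr
  let M : Finset V := Finset.univ.image fun p : Fin r × Fin 2 => f (.inr p)
  have hinj : Function.Injective fun p : Fin r × Fin 2 => f (.inr p) :=
    hf.inj.comp Sum.inr_injective
  have hMT : M ⊆ T := by
    intro x hx
    obtain ⟨p, -, rfl⟩ := Finset.mem_image.mp hx
    exact hT _
  have hM : M.card = 2 * r := by
    rw [Finset.card_image_of_injective _ hinj]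
    simp [mul_comm]
  let U := T \ M
  have hU : ∀ u ∈ U, u ∈ T ∧ ∀ p, f (.inr p) ≠ u := by
    intro u hu
    obtain ⟨h₁, h₂⟩ := Finset.mem_sdiff.mp hu
    exact ⟨h₁, fun p hp => h₂ (Finset.mem_image.mpr ⟨p, Finset.mem_univ _, hp⟩)⟩
  have hMU : Disjoint M U := Finset.disjoint_sdiff
  have hMUT : M ∪ U = T := Finset.union_sdiff_of_subset hMT
  have hcardU : U.card + 2 * r = T.card := by
    rw [← hMUT, Finset.card_union_of_disjoint hMU, hM]; ring
  -- An edge joining two matching edges would merge them into a path, leaving `r - 2 ≥ t` edges.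
  have hcross : ∀ j j' b b', j ≠ j' → ¬ G.Adj (f (.inr (j, b))) (f (.inr (j', b'))) := by
    intro j j' b b' hj hadj
    refine hn (hf.exchange hT ∅ {j, j'} (packs_path (hf.adj_edge j (fin_two_add_one_ne b)) hadj
      (hf.adj_edge j' (fin_two_add_one_ne b').symm) ?_ ?_ ?_) ?_ ?_ ?_ (by simp) ?_)
    · simp [hf.inj.eq_iff, hj]
    · simp [hf.inj.eq_iff, hj]
    · simp [hf.inj.eq_iff, hj]
    · rintro x (rfl | rfl | rfl | rfl) <;> exact hT _
    · exact fun i => i.elim0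
    · intro i hi l
      simp only [Finset.mem_insert, Finset.mem_singleton, not_or] at hi
      simp [hf.inj.eq_iff, hi]
    · simp [Finset.card_pair hj]; omega
  have hUU : ∀ u ∈ U, ∀ u' ∈ U, ¬ G.Adj u u' := by
    intro u hu u' hu' hadj
    refine hmax (hf.exchange hT ∅ ∅ (packs_edge hadj) ?_ ?_ ?_ (by simp) (by simp))
    · rintro x (rfl | rfl)
      exacts [(hU _ hu).1, (hU _ hu').1]
    · exact fun i => i.elim0
    · intro i _ l
      simp [(hU _ hu).2, (hU _ hu').2]
  have hends : ∀ j, ∀ u ∈ U, ∀ u' ∈ U, G.Adj (f (.inr (j, 0))) u → G.Adj (f (.inr (j, 1))) u' →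
      u = u' := by
    intro j u hu u' hu' h₁ h₂
    by_contra hne
    refine hn (hf.exchange hT ∅ {j} (packs_path h₁.symm (hf.edge j) h₂
      ((hU _ hu).2 _).symm hne ((hU _ hu').2 _)) ?_ ?_ ?_ (by simp) ?_)
    · rintro x (rfl | rfl | rfl | rfl)
      exacts [(hU _ hu).1, hT _, hT _, (hU _ hu').1]
    · exact fun i => i.elim0
    · intro i hi l
      simp only [Finset.mem_singleton] at hi
      simp [hf.inj.eq_iff, hi, (hU _ hu).2, (hU _ hu').2]
    · simp; omega
  -- Otherwise one matching edge, `u` and an end of the second edge form a path, at the cost of two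
  -- edges.
  have huniq : ∀ j j' b b', ∀ u ∈ U, G.Adj (f (.inr (j, b))) u → G.Adj (f (.inr (j', b'))) u →
      j = j' := by
    intro j j' b b' u hu h₁ h₂
    by_contra hj
    refine hn (hf.exchange hT ∅ {j, j'} (packs_path (hf.adj_edge j (fin_two_add_one_ne b)) h₁
      h₂.symm ((hU _ hu).2 _) ?_ ?_) ?_ ?_ ?_ (by simp) ?_)
    · simp [hf.inj.eq_iff, hj]
    · simp [hf.inj.eq_iff, hj]
    · rintro x (rfl | rfl | rfl | rfl)
      exacts [hT _, hT _, (hU _ hu).1, hT _]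
    · exact fun i => i.elim0
    · intro i hi l
      simp only [Finset.mem_insert, Finset.mem_singleton, not_or] at hi
      simp [hf.inj.eq_iff, hi, (hU _ hu).2]
    · simp [Finset.card_pair hj]; omega
  have hcount_MM : adjCount G M M ≤ 2 * r := by
    rw [← hM, ← mul_one M.card]
    refine Finset.sum_le_card_nsmul _ _ _ fun x hx => ?_
    obtain ⟨⟨j, b⟩, -, rfl⟩ := Finset.mem_image.mp hx
    refine (Finset.card_le_card (t := {f (.inr (j, b + 1))}) fun y hy => ?_).trans
      (Finset.card_singleton _).le
    obtain ⟨hy, hadj⟩ := Finset.mem_filter.mp hy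
    obtain ⟨⟨j', b'⟩, -, rfl⟩ := Finset.mem_image.mp hy
    obtain rfl : j = j' := by
      by_contra hj
      exact hcross _ _ _ _ hj hadj
    have hb : b ≠ b' := by rintro rfl; exact hadj.ne rfl
    have : b' = b + 1 := by omega
    rw [this]
    exact Finset.mem_singleton_self _
  have hcount_UU : adjCount G U U = 0 := by
    refine Finset.sum_eq_zero fun u hu => ?_
    rw [Finset.card_eq_zero, Finset.filter_eq_empty_iff]
    exact fun u' hu' => hUU u hu u' hu'
  let N : Fin r → Finset V := fun j => U.filter fun u => ∃ b, G.Adj (f (.inr (j, b))) u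
  have hN : ∑ j, (N j).card ≤ U.card := by
    rw [← Finset.card_biUnion]
    · exact Finset.card_le_card (Finset.biUnion_subset.mpr fun j _ => Finset.filter_subset _ _)
    · intro j _ j' _ hj
      refine Finset.disjoint_left.mpr fun u hu hu' => hj ?_
      obtain ⟨hu, b, hb⟩ := Finset.mem_filter.mp hu
      obtain ⟨-, b', hb'⟩ := Finset.mem_filter.mp hu'
      exact huniq _ _ _ _ u hu hb hb'
  -- By `hends`, the ends of a matching edge share at most one neighbour in `U`, so their degrees
  -- into `U` sum to at most `1 + |N j|`; the sets `N j` are disjoint.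
  have hcount_MU : adjCount G M U ≤ r + U.card := by
    have : adjCount G M U ≤ ∑ j : Fin r, (1 + (N j).card) := by
      unfold adjCount
      rw [Finset.sum_image hinj.injOn, Fintype.sum_prod_type]
      refine Finset.sum_le_sum fun j _ => ?_
      rw [Fin.sum_univ_two, ← Finset.card_inter_add_card_union]
      refine add_le_add (Finset.card_le_one.mpr fun u hu u' hu' => ?_)
        (Finset.card_le_card fun u hu => ?_)
      · simp only [Finset.mem_inter, Finset.mem_filter] at hu hu'
        exact hends j u hu.1.1 u' hu'.1.1 hu.1.2 hu'.2.2
      · simp only [Finset.mem_union, Finset.mem_filter] at hu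
        rcases hu with hu | hu
        exacts [Finset.mem_filter.mpr ⟨hu.1, _, hu.2⟩, Finset.mem_filter.mpr ⟨hu.1, _, hu.2⟩]
    rw [Finset.sum_add_distrib] at this
    simp only [Finset.sum_const, Finset.card_univ, Fintype.card_fin, smul_eq_mul, mul_one] at this
    omega
  -- The total is at most `2r + 2(r + |U|) + 0 = 2|T|`.
  rw [← hMUT, adjCount_union_self G hMU, Finset.card_union_of_disjoint hMU, hM]
  omega

/-! ### Edges leaving a path of the packing -/

theorem IsPacking.adj_path_half {V I J : Type*} {G : SimpleGraph V}
    {f : I × Fin 4 ⊕ J × Fin 2 → V} (hf : IsPacking G f) (i : I) :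
    (∀ b : Fin 2, G.Adj (f (.inl (i, ![0, 1] b))) (f (.inl (i, ![0, 1] (b + 1))))) ∧
      ∀ b : Fin 2, G.Adj (f (.inl (i, ![2, 3] b))) (f (.inl (i, ![2, 3] (b + 1)))) := by
  obtain ⟨h₁, -, h₃⟩ := hf.path i
  constructor <;> intro b <;> fin_cases b
  exacts [h₁, h₁.symm, h₃, h₃.symm]

/-- If both halves of a path are joined to different edges of the packing, a path and two edges
can be replaced by two paths. -/
theorem IsPacking.packs_of_adj_halves {V : Type*} {G : SimpleGraph V} {h r : ℕ}
    {f : Fin h × Fin 4 ⊕ Fin r × Fin 2 → V} (hf : IsPacking G f) {i : Fin h} {j j' : Fin r}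
    (hj : j ≠ j') {a a' b b' : Fin 2}
    (h₁ : G.Adj (f (.inl (i, ![0, 1] a))) (f (.inr (j, b))))
    (h₂ : G.Adj (f (.inl (i, ![2, 3] a'))) (f (.inr (j', b')))) :
    Packs G Set.univ (h + 1) (r - 2) := by
  have hb := fin_two_add_one_ne b
  have hb' := fin_two_add_one_ne b'
  have hne : ∀ c d, ![(0 : Fin 4), 1] c ≠ ![2, 3] d := by decide
  have p₁ := packs_path (hf.adj_edge j hb) h₁.symm ((hf.adj_path_half i).1 a)
    (by simp [hf.inj.eq_iff]) (by simp [hf.inj.eq_iff]) (by simp [hf.inj.eq_iff])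
  have p₂ := packs_path (hf.adj_edge j' hb') h₂.symm ((hf.adj_path_half i).2 a')
    (by simp [hf.inj.eq_iff]) (by simp [hf.inj.eq_iff]) (by simp [hf.inj.eq_iff])
  refine hf.exchange (S := Set.univ) (fun _ => trivial) {i} {j, j'} (p₁.union p₂ ?_) (Set.subset_univ _)
    ?_ ?_ ?_ ?_
  · rw [Set.disjoint_left]
    rintro x (rfl | rfl | rfl | rfl) <;> simp [hf.inj.eq_iff, hj, hne]
  · intro i' hi' l
    simp only [Finset.mem_singleton] at hi'
    simp [hf.inj.eq_iff, hi']
  · intro i' hi' l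
    simp only [Finset.mem_insert, Finset.mem_singleton, not_or] at hi'
    simp [hf.inj.eq_iff, hi']
  · have := i.pos
    simp; omega
  · simp [Finset.card_pair hj]

/-- If the vertices of a path have distinct neighbours outside the packing, the path can be
replaced by two paths. -/
theorem IsPacking.packs_of_pendant {V : Type*} {G : SimpleGraph V} {h r : ℕ}
    {f : Fin h × Fin 4 ⊕ Fin r × Fin 2 → V} (hf : IsPacking G f) {i : Fin h} {g : Fin 4 → V}
    (hg : Function.Injective g) (hgf : ∀ l p, g l ≠ f p)
    (hadj : ∀ l, G.Adj (f (.inl (i, l))) (g l)) : Packs G Set.univ (h + 1) r := by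
  have hgf' : ∀ l p, f p ≠ g l := fun l p => (hgf l p).symm
  obtain ⟨e₁, -, e₃⟩ := hf.path i
  have p₁ := packs_path (hadj 0).symm e₁ (hadj 1) (hgf _ _) (by simp [hg.eq_iff]) (hgf' _ _)
  have p₂ := packs_path (hadj 2).symm e₃ (hadj 3) (hgf _ _) (by simp [hg.eq_iff]) (hgf' _ _)
  refine hf.exchange (S := Set.univ) (fun _ => trivial) {i} ∅ (p₁.union p₂ ?_) (Set.subset_univ _)
    ?_ ?_ ?_ (by simp)
  · rw [Set.disjoint_left]
    rintro x (rfl | rfl | rfl | rfl) <;> simp [hf.inj.eq_iff, hg.eq_iff, hgf, hgf']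
  · intro i' hi' l
    simp only [Finset.mem_singleton] at hi'
    simp [hf.inj.eq_iff, hi', hgf']
  · intro i' hi' l
    simp [hf.inj.eq_iff, hgf']
  · have := i.pos
    simp; omega

/-- If two families of numbers at most `4` have supports that meet only in a common index, their
total sum is at most `4 r`. -/
theorem sum_add_sum_le_of_supports {r : ℕ} (hr : 2 ≤ r) (X Y : Fin r → ℕ) (hX : ∀ j, X j ≤ 4)
    (hY : ∀ j, Y j ≤ 4) (hXY : ∀ j j', j ≠ j' → X j ≠ 0 → Y j' = 0) :
    ∑ j, X j + ∑ j, Y j ≤ 4 * r := by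
  have bound : ∀ Z : Fin r → ℕ, (∀ j, Z j ≤ 4) → ∑ j, Z j ≤ 4 * r := by
    intro Z hZ
    simpa [mul_comm] using Finset.sum_le_card_nsmul Finset.univ Z 4 fun j _ => hZ j
  by_cases h₀ : ∀ j, X j = 0
  · simpa [h₀] using bound Y hY
  by_cases h₁ : ∀ j, Y j = 0
  · simpa [h₁] using bound X hX
  push Not at h₀ h₁
  obtain ⟨a, ha⟩ := h₀
  obtain ⟨b, hb⟩ := h₁
  -- When neither family vanishes, each has a single index in its support, so the total is at most
  -- `8 ≤ 4 r`.
  have hXs : ∑ j, X j = X b := Finset.sum_eq_single b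
    (fun j _ hj => by_contra fun h => hb (hXY j b hj h)) (by simp)
  have hYs : ∑ j, Y j = Y a := Finset.sum_eq_single a
    (fun j _ hj => hXY a j hj.symm ha) (by simp)
  have := hX b
  have := hY a
  omega

theorem sum_card_filter_image_edges {V : Type*} [DecidableEq V] {G : SimpleGraph V}
    [DecidableRel G.Adj] {r : ℕ} {e : Fin r × Fin 2 → V} (he : Function.Injective e) (v : V) :
    ((Finset.univ.image e).filter (G.Adj v)).card =
      ∑ j, (Finset.univ.filter fun b => G.Adj v (e (j, b))).card := by
  simp only [Finset.card_filter]
  rw [Finset.sum_image he.injOn, Fintype.sum_prod_type]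

-- Each half of the path sends at most four edges to a matching edge, and by `packs_of_adj_halves`
-- the two halves cannot reach different matching edges; `sum_add_sum_le_of_supports` then applies.
open Classical in
theorem IsPacking.sum_card_adj_edges_le {V : Type*} {G : SimpleGraph V} {h r : ℕ}
    {f : Fin h × Fin 4 ⊕ Fin r × Fin 2 → V} (hf : IsPacking G f) (hr : 2 ≤ r)
    (hn : ¬ Packs G Set.univ (h + 1) (r - 2)) (i : Fin h) :
    ∑ l, ((Finset.univ.image fun p => f (.inr p)).filter (G.Adj (f (.inl (i, l))))).card
      ≤ 4 * r := by
  have he : Function.Injective fun p : Fin r × Fin 2 => f (.inr p) :=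
    hf.inj.comp Sum.inr_injective
  simp only [sum_card_filter_image_edges he]
  rw [Fin.sum_univ_four]
  have hle : ∀ (v : V) (j : Fin r),
      (Finset.univ.filter fun b => G.Adj v (f (.inr (j, b)))).card ≤ 2 := fun v j =>
    (Finset.card_filter_le _ _).trans (by simp)
  have := sum_add_sum_le_of_supports hr
    (fun j => ∑ a, (Finset.univ.filter fun b =>
      G.Adj (f (.inl (i, ![0, 1] a))) (f (.inr (j, b)))).card)
    (fun j => ∑ a, (Finset.univ.filter fun b =>
      G.Adj (f (.inl (i, ![2, 3] a))) (f (.inr (j, b)))).card)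
    (fun j => by
      rw [Fin.sum_univ_two]
      exact add_le_add (hle _ _) (hle _ _))
    (fun j => by
      rw [Fin.sum_univ_two]
      exact add_le_add (hle _ _) (hle _ _)) ?_
  · simp only [Fin.sum_univ_two, Finset.sum_add_distrib] at this
    rw [← add_assoc] at this
    exact this
  · intro j j' hj hX
    by_contra hY
    obtain ⟨a, -, ha⟩ := Finset.exists_ne_zero_of_sum_ne_zero hX
    obtain ⟨a', -, ha'⟩ := Finset.exists_ne_zero_of_sum_ne_zero hY
    obtain ⟨b, hb⟩ := Finset.card_ne_zero.mp ha
    obtain ⟨b', hb'⟩ := Finset.card_ne_zero.mp ha'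
    exact hn (hf.packs_of_adj_halves hj (Finset.mem_filter.mp hb).2 (Finset.mem_filter.mp hb').2)

-- With more than `3|U|` edges, Hall's condition holds for the four neighbourhoods in `U`, giving
-- the distinct neighbours that `packs_of_pendant` needs.
open Classical in
theorem IsPacking.sum_card_adj_outside_le {V : Type*} {G : SimpleGraph V} {h r : ℕ}
    {f : Fin h × Fin 4 ⊕ Fin r × Fin 2 → V} (hf : IsPacking G f)
    (hn : ¬ Packs G Set.univ (h + 1) r) {U : Finset V} (hU : 4 ≤ U.card)
    (hUf : ∀ u ∈ U, ∀ p, u ≠ f p) (i : Fin h) :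
    ∑ l, (U.filter (G.Adj (f (.inl (i, l))))).card ≤ 3 * U.card := by
  by_contra! hlt
  let N : Fin 4 → Finset V := fun l => U.filter (G.Adj (f (.inl (i, l))))
  have hall : ∀ s : Finset (Fin 4), s.card ≤ (s.biUnion N).card := by
    intro s
    by_contra! hs
    have h₁ : ∑ l ∈ s, (N l).card ≤ s.card * (s.card - 1) :=
      Finset.sum_le_card_nsmul _ _ _ fun l hl =>
        (Finset.card_le_card (Finset.subset_biUnion_of_mem N hl)).trans (by omega)
    have h₂ : ∑ l ∈ sᶜ, (N l).card ≤ sᶜ.card * U.card :=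
      Finset.sum_le_card_nsmul _ _ _ fun l _ => Finset.card_filter_le _ _
    have h₃ := Finset.sum_add_sum_compl s fun l => (N l).card
    have h₄ : s.card ≤ 4 := by simpa using Finset.card_le_univ s
    rw [Finset.card_compl, Fintype.card_fin] at h₂
    have h₅ : 0 < s.card := by omega
    change 3 * U.card < ∑ l, (N l).card at hlt
    -- A violating set of size `s` bounds the sum by `s(s - 1) + (4 - s)|U|`, at most `3|U|` for `1
    -- ≤ s ≤ 4` because `|U| ≥ 4`.
    interval_cases s.card <;> omega
  obtain ⟨g, hg, hgN⟩ := (Finset.all_card_le_biUnion_card_iff_exists_injective N).mp hall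
  exact hn (hf.packs_of_pendant hg (fun l => hUf _ (Finset.mem_filter.mp (hgN l)).1)
    fun l => (Finset.mem_filter.mp (hgN l)).2)

/-! ### Edge count and conclusion -/

/-- The vertices split into `W` (paths), `M` (matching) and `U` (uncovered). The summands bound the
ordered pairs inside `W`, twice those from `W` to `M` and `U`, and those inside `Wᶜ`, where a `P₄ ∪
t P₂` would join the `h` paths to form the forbidden packing. -/
theorem two_mul_card_edgeSet_le {V : Type*} [Fintype V] {G : SimpleGraph V} {h t : ℕ}
    (hcard : 8 * h + 2 * t + 4 ≤ Fintype.card V) (hp : Packs G Set.univ h (t + 2))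
    (hn : ¬ Packs G Set.univ (h + 1) t) :
    2 * Nat.card G.edgeSet ≤ 4 * h * (4 * h - 1) +
      2 * (h * (4 * (t + 2)) + h * (3 * (Fintype.card V - 4 * h - 2 * (t + 2)))) +
      2 * (Fintype.card V - 4 * h) := by
  classical
  obtain ⟨f, hf, -⟩ := hp
  have hl : Function.Injective fun p : Fin h × Fin 4 => f (.inl p) :=
    hf.inj.comp Sum.inl_injective
  have hr : Function.Injective fun p : Fin (t + 2) × Fin 2 => f (.inr p) :=
    hf.inj.comp Sum.inr_injective
  let W : Finset V := Finset.univ.image fun p => f (.inl p)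
  let M : Finset V := Finset.univ.image fun p => f (.inr p)
  let U : Finset V := Wᶜ \ M
  have hW : W.card = 4 * h := by
    rw [Finset.card_image_of_injective _ hl]; simp [mul_comm]
  have hM : M.card = 2 * (t + 2) := by
    rw [Finset.card_image_of_injective _ hr]; simp [mul_comm]
  have hWc : Wᶜ.card = Fintype.card V - 4 * h := by rw [Finset.card_compl, hW]
  have hMW : M ⊆ Wᶜ := by
    intro x hx
    obtain ⟨p, -, rfl⟩ := Finset.mem_image.mp hx
    simp [W, hf.inj.eq_iff]
  have hU : U.card = Fintype.card V - 4 * h - 2 * (t + 2) := by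
    rw [Finset.card_sdiff_of_subset hMW, hWc, hM]
  have hMU : Disjoint M U := Finset.disjoint_sdiff
  have hMUW : M ∪ U = Wᶜ := Finset.union_sdiff_of_subset hMW
  have hUf : ∀ u ∈ U, ∀ p, u ≠ f p := by
    rintro u hu p rfl
    simp only [U, W, M, Finset.mem_sdiff, Finset.mem_compl, Finset.mem_image, Finset.mem_univ,
      true_and, not_exists] at hu
    rcases p with p | p
    exacts [hu.1 p rfl, hu.2 p rfl]
  have hrest : adjCount G Wᶜ Wᶜ ≤ 2 * Wᶜ.card := by
    refine adjCount_self_le_of_not_packs G Wᶜ (t := t) ?_ fun hP => hn ?_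
    · refine (hf.packs_image ∅ Finset.univ).mono ?_ le_rfl (by simp)
      rintro _ ⟨⟨p⟩ | p, hp, rfl⟩
      · simp at hp
      · exact hMW (Finset.mem_image_of_mem _ (Finset.mem_univ p))
    · refine ((hf.packs_image Finset.univ ∅).union hP ?_).mono (Set.subset_univ _) (by simp)
        (by simp)
      rw [Set.disjoint_left]
      rintro _ ⟨p | ⟨p⟩, hp, rfl⟩
      · simp [W]
      · simp at hp
  have hWM : adjCount G W M ≤ h * (4 * (t + 2)) := by
    unfold adjCount
    rw [Finset.sum_image hl.injOn, Fintype.sum_prod_type]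
    simpa using Finset.sum_le_card_nsmul Finset.univ _ _ fun i _ =>
      hf.sum_card_adj_edges_le (by omega) hn i
  have hWU : adjCount G W U ≤ h * (3 * U.card) := by
    unfold adjCount
    rw [Finset.sum_image hl.injOn, Fintype.sum_prod_type]
    simpa using Finset.sum_le_card_nsmul Finset.univ _ _ fun i _ =>
      hf.sum_card_adj_outside_le (fun hP => hn (hP.mono le_rfl le_rfl (by omega)))
        -- A path exists only if `h ≥ 1`, and then `|U| ≥ 4h ≥ 4`.
        (by have := i.pos; omega) hUf i
  have hWW := adjCount_self_le G W
  rw [hW] at hWW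
  have hsplit := adjCount_union_self G (disjoint_compl_right (a := W))
  rw [Finset.union_compl, adjCount_univ, ← hMUW, adjCount_union_right G W hMU, hMUW] at hsplit
  rw [hU] at hWU
  rw [hWc] at hrest
  omega

/-- The final comparison with `t = h + 2 + j` and `u = |U|`: then `n = u + 6h + 8 + 2j`, and `u + 3h
+ 6 + j` is `n - p` for `p = 2h + t`. -/
theorem choose_two_add_le {h j u : ℕ} (hu : 4 * h ≤ u) :
    4 * h * (4 * h - 1) + 2 * (h * (4 * (h + 4 + j)) + h * (3 * u)) +
      2 * (u + 2 * (h + 4 + j)) + 2 * (u + 3 * h + 6 + j).choose 2 ≤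
    2 * (u + 6 * h + 8 + 2 * j).choose 2 := by
  have key : ∀ m : ℕ, 2 * m.choose 2 = m * (m - 1) := fun m => by
    rw [Nat.choose_two_right, Nat.mul_div_cancel' (Nat.even_mul_pred_self m).two_dvd]
  rw [key, key]
  obtain ⟨v, rfl⟩ := Nat.exists_eq_add_of_le hu
  have h₁ : 4 * h * (4 * h - 1) ≤ 4 * h * (4 * h) := by gcongr; omega
  have h₂ : 4 * h + v + 3 * h + 6 + j - 1 = 4 * h + v + 3 * h + 5 + j := by omega
  have h₃ : 4 * h + v + 6 * h + 8 + 2 * j - 1 = 4 * h + v + 6 * h + 7 + 2 * j := by omega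
  rw [h₂, h₃]
  nlinarith [Nat.zero_le (h * j), Nat.zero_le (h * v), Nat.zero_le (j * v),
    Nat.zero_le (h * h), Nat.zero_le (j * j)]

/-- A rainbow `h P₄ ∪ (t + 2) P₂` in a colouring with more colours than the anti-Ramsey number of
the matching with `2 h + t + 2` edges gives a rainbow `(h + 1) P₄ ∪ t P₂`. -/
theorem HasRainbowCopy.exchange {n m h t : ℕ} (ht : h + 2 ≤ t) (hn : 8 * h + 2 * t + 4 ≤ n)
    {c : (completeGraph (Fin n)).EdgeLabeling (Fin m)} (hc : Function.Surjective c)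
    (hm : antiRamsey n (disjointCopies (2 * h + t + 2) (pathGraph 2)) < m)
    (hr : HasRainbowCopy c
      (disjointCopies h (pathGraph 4) ⊕g disjointCopies (t + 2) (pathGraph 2))) :
    HasRainbowCopy c (disjointCopies (h + 1) (pathGraph 4) ⊕g disjointCopies t (pathGraph 2)) := by
  obtain ⟨G, hG, hcard, htr⟩ := hr.exists_transversal hc
  refine .of_injOn htr (packs_univ_iff.mp (by_contra fun hcon => ?_))
  have h₁ := two_mul_card_edgeSet_le (by simpa using hn) (packs_univ_iff.mpr hG) hcon
  have h₂ := le_antiRamsey_matching (n := n) (p := 2 * h + t) (by omega)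
  rw [hcard, Nat.card_eq_fintype_card, Fintype.card_fin, Fintype.card_fin] at h₁
  obtain ⟨j, rfl⟩ := Nat.exists_eq_add_of_le ht
  obtain ⟨u, rfl⟩ : ∃ u, n = u + 6 * h + 8 + 2 * j := ⟨n - 6 * h - 8 - 2 * j, by omega⟩
  have h₃ := choose_two_add_le (h := h) (j := j) (u := u) (by omega)
  rw [show u + 6 * h + 8 + 2 * j - 4 * h - 2 * (h + 2 + j + 2) = u by omega,
    show u + 6 * h + 8 + 2 * j - 4 * h = u + 2 * (h + 4 + j) by omega,
    show h + 2 + j + 2 = h + 4 + j by omega] at h₁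
  rw [show u + 6 * h + 8 + 2 * j - (2 * h + (h + 2 + j)) = u + 3 * h + 6 + j by omega] at h₂
  omega

theorem theorem1 (k t n : ℕ) (hk : 2 ≤ k + 1) (ht : k + 1 ≤ t)
    (hn : 8 * k + 2 * t - 4 ≤ n) :
    antiRamsey n (disjointCopies k (pathGraph 4) ⊕g disjointCopies t (pathGraph 2)) =
      antiRamsey n (disjointCopies (2 * k + t) (pathGraph 2)) := by
  apply le_antisymm
  · refine csSup_le' fun m hm => ?_
    obtain ⟨c, hc, hfree⟩ := hm
    by_contra! hlt
    have hmatch : HasRainbowCopy c (disjointCopies (2 * k + t) (pathGraph 2)) := by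
      by_contra hcon
      exact hlt.not_ge (le_csSup (bddAbove_rainbowFreeColorCounts _ _) ⟨c, hc, hcon⟩)
    -- The number `2h + (t + 2d)` stays equal to `2k + t`, so every exchange uses the same bound on
    -- colours. The hypotheses on `t` and `n` are exactly what the last exchange (`h = k - 1`, `d =
    -- 0`) needs.
    have hall : ∀ h d, h + d = k → HasRainbowCopy c
        (disjointCopies h (pathGraph 4) ⊕g disjointCopies (t + 2 * d) (pathGraph 2)) := by
      intro h
      induction h with
      | zero =>
        rintro d hd
        obtain rfl : d = k := by omega
        rw [add_comm t]
        exact hmatch.of_isContained (sum_isContained_disjointCopies_path_two _)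
      | succ h ih =>
        intro d hd
        refine HasRainbowCopy.exchange (by omega) (by omega) hc ?_ (ih (d + 1) (by omega))
        rwa [show 2 * h + (t + 2 * d) + 2 = 2 * k + t by omega]
    exact hfree (hall k 0 rfl)
  · refine csSup_le' fun m hm => le_csSup (bddAbove_rainbowFreeColorCounts _ _) ?_
    obtain ⟨c, hc, hfree⟩ := hm
    refine ⟨c, hc, fun h => hfree (h.of_isContained ?_)⟩
    exact (disjointCopies_path_two_isContained_sum _).trans
      (packs_univ_iff.mp (packs_univ_iff.mpr (IsContained.refl _)).split_paths)
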